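/- All graphs are finite and simple. For a graph $G$ with an edge-coloring (adjacent edges may receive the same color), a monochromatic $uv$-cut is a set $F$ of edges of $G$, all of the same color, such that $u$ and $v$ lie in different components of $G-F$. The coloring is an MD-coloring if every two distinct vertices $u,v$ have a monochromatic $uv$-cut, and the monochromatic disconnection number $md(G)$ is the maximum number of colors appearing on the edges of $G$ in an MD-coloring of $G$. Theorem. Let $G$ be a graph on $n$ vertices such that both $G$ and its complement $\overline{G}$ are connected. Then $md(G)+md(\overline{G})\le n+1$ if $n\ge 5$, and $md(G)+md(\overline{G})\ge 2$ if $n\ge 8$. Both bounds are sharp: (1) for every $n\ge 5$ there is a tree on $n$ vertices with maximum degree $n-2$, and every such tree $G$ has a connected complement and satisfies $md(G)+md(\overline{G})=n+1$; (2) for every $n\ge 8$ there is a bipartite graph $G$ on $n$ vertices such that $G$ and $\overline{G}$ are both connected and $md(G)=md(\overline{G})=1$, so that $md(G)+md(\overline{G})=2$. -/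

import Mathlib

/-- The edge set `F` is a monochromatic `uv`-cut of the graph `G` with edge-coloring `Γ`: all edges
of `F` have the same color, and `u`, `v` lie in different components of `G - F`.
An edge-coloring is given as a function on all unordered pairs, only its values on the
edges of `G` being relevant. -/
def IsMonochromaticCut {V : Type*} (G : SimpleGraph V) (Γ : Sym2 V → ℕ) (u v : V)
    (F : Set (Sym2 V)) : Prop :=
  F ⊆ G.edgeSet ∧ (∀ e ∈ F, ∀ f ∈ F, Γ e = Γ f) ∧ ¬ (G.deleteEdges F).Reachable u v

/-- `Γ` is a monochromatic disconnection coloring of `G`: any two distinct vertices are separated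
by a monochromatic edge-cut. -/
def IsMDColoring {V : Type*} (G : SimpleGraph V) (Γ : Sym2 V → ℕ) : Prop :=
  ∀ u v : V, u ≠ v → ∃ F : Set (Sym2 V), IsMonochromaticCut G Γ u v F

/-- The numbers of colors that occur on the edges of `G` in its monochromatic disconnection
colorings. -/
def mdColorCounts {V : Type*} (G : SimpleGraph V) : Set ℕ :=
  {k | ∃ Γ : Sym2 V → ℕ, IsMDColoring G Γ ∧ (Γ '' G.edgeSet).ncard = k}

/-- The monochromatic disconnection number: the maximum number of colors in a monochromatic
disconnection coloring of `G`. -/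
noncomputable def md {V : Type*} (G : SimpleGraph V) : ℕ :=
  sSup (mdColorCounts G)

/-- For a finite graph the supremum defining `md` is a maximum. -/
theorem md_isGreatest {V : Type*} [Finite V] (G : SimpleGraph V) :
    IsGreatest (mdColorCounts G) (md G) := by
  have hbdd : BddAbove (mdColorCounts G) := by
    refine ⟨G.edgeSet.ncard, ?_⟩
    rintro k ⟨Γ, -, rfl⟩
    exact Set.ncard_image_le (Set.toFinite _)
  have hne : (mdColorCounts G).Nonempty := by
    refine ⟨_, fun _ => 0, fun u v huv => ⟨G.edgeSet, subset_rfl, fun _ _ _ _ => rfl, ?_⟩, rfl⟩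
    have h : G.deleteEdges G.edgeSet = ⊥ := by
      ext a b
      simp
    rw [h, SimpleGraph.reachable_bot]
    exact huv
  exact ⟨Nat.sSup_mem hne hbdd, fun k hk => le_csSup hbdd hk⟩

/-!
For adjacent `u`, `v` the class of the color of `uv` is the only one that can separate them. So
every color occurs on every connected spanning subgraph, and a spanning tree gives `md G ≤ n - 1`
(`md_add_one_le_card`); also triangles are monochromatic and opposite edges of four-cycles have
equal colors.

The upper bound is proved by induction on `n`, deleting one vertex at a time. If `G - x` is
connected, then `md G ≤ md (G - x)`, except that a pendant vertex `x` may contribute one color of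
its own (`exists_pendant_or_md_le`, `md_le_md_induce_add_one`). A vertex cannot be pendant in both
`G` and its complement, so `md G + md Gᶜ` grows by at most one per vertex. What makes the induction
run is `exists_removable`: on at least five vertices, some vertex can be deleted with both graphs
remaining connected. The induction starts at `n = 5`. There the deletion leads to graphs on four
vertices with `md ≤ 3` each, and if the deleted vertex is pendant in one of the two graphs, then the
other one has `md ≤ 2` (`md_le_two_of_dominating`).

For a tree with a vertex `v` adjacent to all others but one, all edges may receive different colors,
while `v` is pendant in the complement, which therefore admits two colors; equality follows from
the upper bound. For the lower bound, removing a path of length three from a complete bipartite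
graph with parts of at least four vertices leaves a graph in which four-cycles force a single color,
and in whose complement triangles do.
-/

open SimpleGraph

/-! ### Color classes as cuts -/

/-- In an MD-coloring the cut separating two vertices can be taken to be a whole color class. -/
theorem IsMDColoring.exists_color {V : Type*} {G : SimpleGraph V} {Γ : Sym2 V → ℕ}
    (h : IsMDColoring G Γ) {u v : V} (huv : u ≠ v) :
    ∃ i, ¬ (G.deleteEdges {e | Γ e = i}).Reachable u v := by
  obtain ⟨F, -, hmono, hF⟩ := h u v huv
  rcases F.eq_empty_or_nonempty with rfl | ⟨e, he⟩
  · refine ⟨0, fun hr => hF (hr.mono ?_)⟩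
    simp
  · exact ⟨Γ e, fun hr => hF (hr.mono (deleteEdges_anti fun f hf => hmono f hf e he))⟩

theorem isMDColoring_of_exists_color {V : Type*} {G : SimpleGraph V} {Γ : Sym2 V → ℕ}
    (h : ∀ u v, u ≠ v → ∃ i, ¬ (G.deleteEdges {e | Γ e = i}).Reachable u v) :
    IsMDColoring G Γ := by
  intro u v huv
  obtain ⟨i, hi⟩ := h u v huv
  refine ⟨{e | Γ e = i} ∩ G.edgeSet, Set.inter_subset_right, ?_, ?_⟩
  · rintro e ⟨he, -⟩ f ⟨hf, -⟩
    exact he.trans hf.symm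
  · rwa [← deleteEdges_eq_inter_edgeSet]

/-- The color class that separates the ends of an edge can only be that of the edge itself. -/
theorem IsMDColoring.not_reachable {V : Type*} {G : SimpleGraph V} {Γ : Sym2 V → ℕ}
    (h : IsMDColoring G Γ) {u v : V} (huv : G.Adj u v) :
    ¬ (G.deleteEdges {e | Γ e = Γ s(u, v)}).Reachable u v := by
  obtain ⟨i, hi⟩ := h.exists_color huv.ne
  by_cases hc : Γ s(u, v) = i
  · rwa [hc]
  · exact absurd (Adj.reachable (by simp [huv, hc])) hi

theorem IsMDColoring.comap {V W : Type*} {G : SimpleGraph V} {Γ : Sym2 V → ℕ}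
    (h : IsMDColoring G Γ) (f : W ↪ V) : IsMDColoring (G.comap f) (Γ ∘ Sym2.map f) := by
  refine isMDColoring_of_exists_color fun u v huv => ?_
  obtain ⟨i, hi⟩ := h.exists_color (f.injective.ne huv)
  refine ⟨i, fun hr => hi ?_⟩
  let g : (G.comap f).deleteEdges {e | (Γ ∘ Sym2.map f) e = i} →g G.deleteEdges {e | Γ e = i} :=
    ⟨f, by intro a b hab; simpa using hab⟩
  exact hr.map g

/-! ### Short cycles -/

theorem IsMDColoring.triangle {V : Type*} {G : SimpleGraph V} {Γ : Sym2 V → ℕ}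
    (h : IsMDColoring G Γ) {a b c : V} (hab : G.Adj a b) (hbc : G.Adj b c) (hac : G.Adj a c) :
    Γ s(a, b) = Γ s(a, c) := by
  by_contra hne
  by_cases hb : Γ s(b, c) = Γ s(a, b)
  -- otherwise `ac`, or else `ab`, is the only edge of the triangle with its color
  · refine h.not_reachable hac (Reachable.trans (v := b) ?_ ?_) <;> apply Adj.reachable
    · simp [hab, hne]
    · simp [hbc, hb, hne]
  · refine h.not_reachable hab (Reachable.trans (v := c) ?_ ?_) <;> apply Adj.reachable
    · simp [hac, Ne.symm hne]
    · simp [hbc.symm, Sym2.eq_swap ▸ hb]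

/-- Opposite edges of a four-cycle have the same color: otherwise some edge of the cycle is the
only one of its color, or two colors each occupy a path of length two, and then no color class
separates the common ends of these two paths. -/
theorem IsMDColoring.four_cycle {V : Type*} {G : SimpleGraph V} {Γ : Sym2 V → ℕ}
    (h : IsMDColoring G Γ) {a b c d : V} (hab : G.Adj a b) (hbc : G.Adj b c) (hcd : G.Adj c d)
    (hda : G.Adj d a) (hac : a ≠ c) (hbd : b ≠ d) : Γ s(a, b) = Γ s(c, d) := by
  by_contra hne
  have key : ∀ {a b c d : V}, G.Adj a b → G.Adj b c → G.Adj c d → G.Adj d a →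
      Γ s(a, b) = Γ s(b, c) ∨ Γ s(a, b) = Γ s(c, d) ∨ Γ s(a, b) = Γ s(d, a) := by
    intro a b c d hab hbc hcd hda
    by_contra! hcon
    obtain ⟨h1, h2, h3⟩ := hcon
    refine h.not_reachable hab
      (((Adj.reachable (v := d) ?_).trans (Adj.reachable (v := c) ?_)).trans (Adj.reachable ?_))
    · simpa [hda.symm, Sym2.eq_swap] using Ne.symm h3
    · simpa [hcd.symm, Sym2.eq_swap] using Ne.symm h2
    · simpa [hbc.symm, Sym2.eq_swap] using Ne.symm h1
  have k1 := key hab hbc hcd hda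
  have k2 := key hbc hcd hda hab
  have k3 := key hcd hda hab hbc
  have k4 := key hda hab hbc hcd
  obtain ⟨i, hi⟩ := h.exists_color hac
  obtain ⟨j, hj⟩ := h.exists_color hbd
  have path : ∀ {a b c : V} {i : ℕ}, G.Adj a b → G.Adj b c →
      ¬ (G.deleteEdges {e | Γ e = i}).Reachable a c → Γ s(a, b) = i ∨ Γ s(b, c) = i := by
    intro a b c i hab hbc hn
    by_contra! hcon
    exact hn ((Adj.reachable (v := b) (by simp [hab, hcon.1])).trans
      (Adj.reachable (by simp [hbc, hcon.2])))
  have p1 := path hab hbc hi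
  have p2 := path hda.symm hcd.symm hi
  have p3 := path hbc hcd hj
  have p4 := path hab.symm hda.symm hj
  rw [Sym2.eq_swap (a := a) (b := d), Sym2.eq_swap (a := d) (b := c)] at p2
  rw [Sym2.eq_swap (a := b) (b := a), Sym2.eq_swap (a := a) (b := d)] at p4
  omega

/-! ### Comparing `md` of a graph and of smaller graphs -/

theorem ncard_image_le_md {V : Type*} [Finite V] {G : SimpleGraph V} {Γ : Sym2 V → ℕ}
    (h : IsMDColoring G Γ) : (Γ '' G.edgeSet).ncard ≤ md G :=
  (md_isGreatest G).2 ⟨Γ, h, rfl⟩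

theorem md_le_of_forall {V : Type*} [Finite V] {G : SimpleGraph V} {k : ℕ}
    (h : ∀ Γ, IsMDColoring G Γ → (Γ '' G.edgeSet).ncard ≤ k) : md G ≤ k := by
  obtain ⟨Γ, hΓ, hk⟩ := (md_isGreatest G).1
  exact hk ▸ h Γ hΓ

/-- Every color occurs on every connected spanning subgraph, because its class separates the ends
of an edge. -/
theorem IsMDColoring.image_subset {V : Type*} {G T : SimpleGraph V} {Γ : Sym2 V → ℕ}
    (h : IsMDColoring G Γ) (hT : T.Preconnected) (hTG : T ≤ G) :
    Γ '' G.edgeSet ⊆ Γ '' T.edgeSet := by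
  rintro _ ⟨e, he, rfl⟩
  induction e with | _ u v
  by_contra hcon
  refine h.not_reachable he ((hT u v).mono fun a b hab => ?_)
  exact deleteEdges_adj.2 ⟨hTG hab, fun hc => hcon ⟨s(a, b), hab, hc⟩⟩

/-- A spanning tree carries all colors. -/
theorem md_add_one_le_card {V : Type*} [Finite V] {G : SimpleGraph V} (hG : G.Connected) :
    md G + 1 ≤ Nat.card V := by
  obtain ⟨T, hTG, hT⟩ := hG.exists_isTree_le
  have hcard := (isTree_iff_connected_and_card.1 hT).2
  refine hcard ▸ Nat.add_le_add_right (md_le_of_forall fun Γ hΓ => ?_) 1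
  calc (Γ '' G.edgeSet).ncard ≤ (Γ '' T.edgeSet).ncard :=
        Set.ncard_le_ncard (hΓ.image_subset hT.connected.preconnected hTG) (Set.toFinite _)
    _ ≤ T.edgeSet.ncard := Set.ncard_image_le (Set.toFinite _)
    _ = Nat.card T.edgeSet := rfl

theorem one_le_md {V : Type*} [Finite V] [Nontrivial V] {G : SimpleGraph V} (hG : G.Connected) :
    1 ≤ md G := by
  obtain ⟨v⟩ := hG.nonempty
  obtain ⟨w, hw⟩ := hG.preconnected.exists_adj_of_nontrivial v
  have hΓ : IsMDColoring G (fun _ => 0) := by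
    refine isMDColoring_of_exists_color fun a b hab => ⟨0, ?_⟩
    simpa using hab
  refine le_trans ?_ (ncard_image_le_md hΓ)
  exact (Set.ncard_pos (Set.toFinite _)).2 ⟨0, s(v, w), hw, rfl⟩

/-- A color that is used only at a vertex `x` whose deletion leaves the graph connected is used
only when `x` is pendant. For if `xy` has that color and `z` is another neighbor of `x`, then `y`
and `z` are joined in `G - x` by a path without that color. Hence `xz` has the same color, and
together with the path `y x z` this prevents every color class from separating `y` and `z`. -/
theorem IsMDColoring.eq_of_color_not_mem {V : Type*} {G : SimpleGraph V} {Γ : Sym2 V → ℕ}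
    (h : IsMDColoring G Γ) {x y z : V} (hx : (G.induce {x}ᶜ).Connected) (hy : G.Adj x y)
    (hz : G.Adj x z)
    (hnot : ∀ a b, a ≠ x → b ≠ x → G.Adj a b → Γ s(a, b) ≠ Γ s(x, y)) : y = z := by
  by_contra hyz
  have hr : (G.deleteEdges {e | Γ e = Γ s(x, y)}).Reachable z y := by
    let g : G.induce {x}ᶜ →g G.deleteEdges {e | Γ e = Γ s(x, y)} :=
      ⟨Subtype.val, fun {a b} hab => deleteEdges_adj.2 ⟨hab, hnot a b a.2 b.2 hab⟩⟩
    exact (hx.preconnected ⟨z, hz.ne'⟩ ⟨y, hy.ne'⟩).map g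
  have hzc : Γ s(x, z) = Γ s(x, y) := by
    by_contra hne
    exact h.not_reachable hy ((Adj.reachable (by simp [hz, hne])).trans hr)
  obtain ⟨i, hi⟩ := h.exists_color hyz
  by_cases hc : Γ s(x, y) = i
  · exact hi (hc ▸ hr.symm)
  · refine hi (Reachable.trans (v := x) ?_ ?_) <;> apply Adj.reachable
    · simp [hy.symm, Sym2.eq_swap (a := y) (b := x), hc]
    · simp [hz, hzc, hc]

theorem image_induce_subset {V : Type*} {G : SimpleGraph V} (Γ : Sym2 V → ℕ) (x : V) :
    Γ '' G.edgeSet ⊆ ((Γ ∘ Sym2.map Subtype.val) '' (G.induce {x}ᶜ).edgeSet) ∪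
      {i | ∃ y, G.Adj x y ∧ Γ s(x, y) = i} := by
  rintro _ ⟨e, he, rfl⟩
  induction e with | _ u v
  by_cases hu : u = x
  · exact Or.inr ⟨v, hu ▸ he, by rw [hu]⟩
  by_cases hv : v = x
  · exact Or.inr ⟨u, hv ▸ (show G.Adj u v from he).symm, by rw [hv, Sym2.eq_swap]⟩
  exact Or.inl ⟨s(⟨u, hu⟩, ⟨v, hv⟩), he, rfl⟩

theorem IsMDColoring.ncard_induce_le_md {V : Type*} [Finite V] {G : SimpleGraph V}
    {Γ : Sym2 V → ℕ} (h : IsMDColoring G Γ) (s : Set V) :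
    ((Γ ∘ Sym2.map Subtype.val) '' (G.induce s).edgeSet).ncard ≤ md (G.induce s) :=
  ncard_image_le_md (h.comap (Function.Embedding.subtype _))

theorem md_le_md_induce {V : Type*} [Finite V] {G : SimpleGraph V} {x y z : V}
    (hx : (G.induce {x}ᶜ).Connected) (hy : G.Adj x y) (hz : G.Adj x z) (hyz : y ≠ z) :
    md G ≤ md (G.induce {x}ᶜ) := by
  refine md_le_of_forall fun Γ h => le_trans (Set.ncard_le_ncard ?_ (Set.toFinite _))
    (h.ncard_induce_le_md _)
  refine (image_induce_subset Γ x).trans (Set.union_subset subset_rfl ?_)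
  rintro _ ⟨w, hw, rfl⟩
  by_contra hcon
  have hnot : ∀ a b, a ≠ x → b ≠ x → G.Adj a b → Γ s(a, b) ≠ Γ s(x, w) :=
    fun a b ha hb hab hc => hcon ⟨s(⟨a, ha⟩, ⟨b, hb⟩), hab, hc⟩
  exact hyz ((h.eq_of_color_not_mem hx hw hy hnot).symm.trans
    (h.eq_of_color_not_mem hx hw hz hnot))

theorem md_le_md_induce_add_one {V : Type*} [Finite V] {G : SimpleGraph V} {x y : V}
    (hy : ∀ z, G.Adj x z → z = y) : md G ≤ md (G.induce {x}ᶜ) + 1 := by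
  refine md_le_of_forall fun Γ h => ?_
  have hsub : Γ '' G.edgeSet ⊆
      insert (Γ s(x, y)) ((Γ ∘ Sym2.map Subtype.val) '' (G.induce {x}ᶜ).edgeSet) := by
    refine (image_induce_subset Γ x).trans (Set.union_subset (Set.subset_insert _ _) ?_)
    rintro _ ⟨w, hw, rfl⟩
    exact Or.inl (by rw [hy w hw])
  refine (Set.ncard_le_ncard hsub (Set.toFinite _)).trans ((Set.ncard_insert_le _ _).trans ?_)
  exact Nat.add_le_add_right (h.ncard_induce_le_md _) 1

/-! ### Deleting a vertex while keeping a graph and its complement connected -/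

/-- If `G - x` is disconnected, its vertices split into two nonempty parts without edges between
them. -/
theorem exists_separation {V : Type*} {G : SimpleGraph V} {x y : V} (hxy : y ≠ x)
    (h : ¬ (G.induce {x}ᶜ).Connected) :
    ∃ A : Set V, x ∉ A ∧ A.Nonempty ∧ (∃ b, b ∉ A ∧ b ≠ x) ∧
      ∀ u ∈ A, ∀ w, w ∉ A → w ≠ x → ¬ G.Adj u w := by
  have : Nonempty ({x}ᶜ : Set V) := ⟨⟨y, hxy⟩⟩
  rw [connected_iff, and_iff_left this] at h
  simp only [Preconnected, not_forall] at h
  obtain ⟨a, b, hab⟩ := h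
  refine ⟨{v | ∃ hv : v ≠ x, (G.induce {x}ᶜ).Reachable a ⟨v, hv⟩}, ?_, ⟨a, a.2, .rfl⟩,
    ⟨b, ?_, b.2⟩, ?_⟩
  · rintro ⟨hx, -⟩
    exact hx rfl
  · rintro ⟨_, hr⟩
    exact hab hr
  · rintro u ⟨hu, hr⟩ w hw hwx huw
    exact hw ⟨hwx, hr.trans (Adj.reachable (show (G.induce {x}ᶜ).Adj ⟨u, hu⟩ ⟨w, hwx⟩ from huw))⟩

/-- A graph is connected after the deletion of `z` if every vertex can be reached from some
vertex `c` in at most two steps avoiding `z`. -/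
theorem connected_induce_of_near {V : Type*} {G : SimpleGraph V} {z c : V} (hc : c ≠ z)
    (h : ∀ v, v ≠ z → v ≠ c → G.Adj c v ∨ ∃ w, w ≠ z ∧ G.Adj c w ∧ G.Adj w v) :
    (G.induce {z}ᶜ).Connected := by
  refine connected_iff_exists_forall_reachable _ |>.2 ⟨⟨c, hc⟩, ?_⟩
  rintro ⟨v, hv⟩
  by_cases hvc : v = c
  · subst hvc
    exact .rfl
  rcases h v hv hvc with h1 | ⟨w, hw, h1, h2⟩
  · exact Adj.reachable (show (G.induce {z}ᶜ).Adj ⟨c, hc⟩ ⟨v, hv⟩ from h1)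
  · exact (Adj.reachable (show (G.induce {z}ᶜ).Adj ⟨c, hc⟩ ⟨w, hw⟩ from h1)).trans
      (Adj.reachable (show (G.induce {z}ᶜ).Adj ⟨w, hw⟩ ⟨v, hv⟩ from h2))

/-- Deleting a vertex at maximum distance from some other vertex leaves the graph connected. -/
theorem connected_induce_of_farthest {V : Type*} {G : SimpleGraph V} (hG : G.Connected) {y z : V}
    (hyz : y ≠ z) (hz : ∀ v, G.dist y v ≤ G.dist y z) : (G.induce {z}ᶜ).Connected := by
  refine connected_iff_exists_forall_reachable _ |>.2 ⟨⟨y, hyz⟩, ?_⟩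
  have key : ∀ k v (hv : v ≠ z), G.dist y v = k →
      (G.induce {z}ᶜ).Reachable ⟨y, hyz⟩ ⟨v, hv⟩ := by
    intro k
    induction k with
    | zero =>
      intro v hv h
      obtain rfl := hG.dist_eq_zero_iff.1 h
      exact .rfl
    | succ k ih =>
      intro v hv h
      obtain ⟨p, hp⟩ := hG.exists_walk_length_eq_dist y v
      have hnil : ¬ p.Nil := by
        intro hn
        have := Walk.length_eq_zero_iff.2 hn
        omega
      have hadj := p.adj_penultimate hnil
      have h1 : G.dist y p.penultimate ≤ k := by
        refine (dist_le p.dropLast).trans ?_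
        simp only [Walk.length_dropLast]
        omega
      have h2 := hG.dist_triangle (u := y) (v := p.penultimate) (w := v)
      rw [dist_eq_one_iff_adj.2 hadj] at h2
      have hne : p.penultimate ≠ z := by
        intro he
        have := hz v
        rw [← he] at this
        omega
      exact (ih _ hne (by omega)).trans
        (Adj.reachable (show (G.induce {z}ᶜ).Adj ⟨_, hne⟩ ⟨v, hv⟩ from hadj))
  rintro ⟨v, hv⟩
  exact key _ v hv rfl

/-- Two graphs complementary to each other. Unlike `H = Gᶜ`, this is visibly symmetric and passes
to induced subgraphs. -/
def Complementary {V : Type*} (G H : SimpleGraph V) : Prop :=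
  ∀ u v, u ≠ v → (G.Adj u v ↔ ¬ H.Adj u v)

theorem Complementary.symm {V : Type*} {G H : SimpleGraph V} (h : Complementary G H) :
    Complementary H G := fun u v huv => by rw [h u v huv, not_not]

theorem Complementary.induce {V : Type*} {G H : SimpleGraph V} (h : Complementary G H)
    (s : Set V) : Complementary (G.induce s) (H.induce s) :=
  fun u v huv => h u v (Subtype.coe_injective.ne huv)

theorem complementary_compl {V : Type*} (G : SimpleGraph V) : Complementary G Gᶜ :=
  fun u v huv => by simp [huv]

/-- If `x` is pendant in `G` at `y`, then `x` is adjacent in the complement `H` to everything but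
`y`, so `H` stays connected as long as `y` keeps an `H`-neighbor. If `y` has two of these, any
vertex farthest from `y` in `G` can be deleted. Otherwise `y` is adjacent in `G` to all vertices
but one. -/
theorem exists_removable_of_pendant {V : Type*} [Finite V] {G H : SimpleGraph V}
    (hGH : Complementary G H) (hG : G.Connected) (hH : H.Connected) (hcard : 5 ≤ Nat.card V)
    {x y : V} (hxy : x ≠ y) (hpend : ∀ w, G.Adj x w → w = y) :
    ∃ z, (G.induce {z}ᶜ).Connected ∧ (H.induce {z}ᶜ).Connected := by
  have : Nontrivial V := ⟨x, y, hxy⟩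
  have hxyG : G.Adj x y := by
    obtain ⟨w, hw⟩ := hG.preconnected.exists_adj_of_nontrivial x
    exact hpend w hw ▸ hw
  have hxH : ∀ w, w ≠ x → w ≠ y → H.Adj x w := fun w hwx hwy =>
    (hGH.symm x w hwx.symm).2 fun h => hwy (hpend w h)
  have hyxH : ¬ H.Adj y x := (hGH y x hxy.symm).1 hxyG.symm
  -- `H - z` is connected as soon as `y` has a neighbor other than `z`
  have hHz : ∀ z h, z ≠ x → H.Adj y h → h ≠ z → (H.induce {z}ᶜ).Connected := by
    intro z h hzx hyh hhz
    refine connected_induce_of_near hzx.symm fun v hvz hvx => ?_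
    by_cases hvy : v = y
    · subst hvy
      have hhx : h ≠ x := fun e => hyxH (e ▸ hyh)
      exact Or.inr ⟨h, hhz, hxH h hhx hyh.ne', hyh.symm⟩
    · exact Or.inl (hxH v hvx hvy)
  obtain ⟨h, hh⟩ := hH.preconnected.exists_adj_of_nontrivial y
  have hhx : h ≠ x := fun e => hyxH (e ▸ hh)
  by_cases hex : ∃ h', H.Adj y h' ∧ h' ≠ h
  · obtain ⟨h', hh', hne⟩ := hex
    obtain ⟨z, hz⟩ := Finite.exists_max (fun v => G.dist y v)
    have hd : G.dist y h ≠ 0 ∧ G.dist y h ≠ 1 := by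
      refine ⟨fun e => hh.ne (hG.dist_eq_zero_iff.1 e), fun e => ?_⟩
      exact (hGH y h hh.ne).1 (dist_eq_one_iff_adj.1 e) hh
    have hdz := hz h
    have hzy : y ≠ z := by
      rintro rfl
      simp only [dist_self] at hdz
      omega
    have hzx : z ≠ x := by
      rintro rfl
      rw [dist_eq_one_iff_adj.2 hxyG.symm] at hdz
      omega
    refine ⟨z, connected_induce_of_farthest hG hzy hz, ?_⟩
    by_cases hhz : h = z
    · exact hHz z h' hzx hh' (hhz ▸ hne)
    · exact hHz z h hzx hh hhz
  · push Not at hex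
    have hyG : ∀ w, w ≠ y → w ≠ h → G.Adj y w := fun w hwy hwh =>
      (hGH y w hwy.symm).2 fun e => hwh (hex w e)
    obtain ⟨w, hw⟩ := hG.preconnected.exists_adj_of_nontrivial h
    have hwy : w ≠ y := by
      rintro rfl
      exact (hGH _ _ hw.ne').1 hw.symm hh
    obtain ⟨z, hz⟩ : ∃ z, z ∉ ({x, y, h, w} : Set V) := by
      by_contra! hcon
      have h1 : (Set.univ : Set V) ⊆ {x, y, h, w} := fun v _ => hcon v
      have h2 := Set.ncard_le_ncard h1 (Set.toFinite _)
      rw [Set.ncard_univ] at h2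
      have h3 := Set.ncard_insert_le x {y, h, w}
      have h4 := Set.ncard_insert_le y {h, w}
      have h5 := Set.ncard_insert_le h {w}
      rw [Set.ncard_singleton] at h5
      omega
    simp only [Set.mem_insert_iff, Set.mem_singleton_iff, not_or] at hz
    refine ⟨z, connected_induce_of_near (Ne.symm hz.2.1) fun v hvz hvy => ?_,
      hHz z h hz.1 hh (Ne.symm hz.2.2.1)⟩
    by_cases hvh : v = h
    · subst hvh
      exact Or.inr ⟨w, Ne.symm hz.2.2.2, hyG w hwy hw.ne', hw.symm⟩
    · exact Or.inl (hyG v hvy hvh)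

/-- If `G - x` and `H - y` are connected but `H - x` and `G - y` are not, then `x` is pendant in
`G` at `y`, or `y` is pendant in `H` at `x`: otherwise the complete bipartite graph that `G`
contains on the vertices other than `x` stays connected when `y` is deleted as well. -/
theorem pendant_or_pendant {V : Type*} {G H : SimpleGraph V} (hGH : Complementary G H)
    {x y : V} (hxy : x ≠ y) (hHx : ¬ (H.induce {x}ᶜ).Connected)
    (hGy : ¬ (G.induce {y}ᶜ).Connected) :
    (∀ w, G.Adj x w → w = y) ∨ (∀ w, H.Adj y w → w = x) := by
  by_contra! hcon
  obtain ⟨⟨w₁, hw₁, hw₁y⟩, w₂, hw₂, hw₂x⟩ := hcon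
  obtain ⟨A, hxA, ⟨a, ha⟩, ⟨b, hb, hbx⟩, hA⟩ := exists_separation hxy.symm hHx
  obtain ⟨C, hyC, ⟨c, hc⟩, ⟨d, hd, hdy⟩, hC⟩ := exists_separation hxy hGy
  have hax : a ≠ x := fun e => hxA (e ▸ ha)
  have hcy : c ≠ y := fun e => hyC (e ▸ hc)
  have hw₁x := hw₁.ne'
  have hw₂y := hw₂.ne'
  have hA' : ∀ u v, u ≠ x → v ≠ x → H.Adj u v → (u ∈ A ↔ v ∈ A) := by
    intro u v hu hv huv
    by_contra hne
    by_cases hu' : u ∈ A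
    · exact hA u hu' v (by tauto) hv huv
    · exact hA v (by tauto) u hu' hu huv.symm
  have hC' : ∀ u v, u ≠ y → v ≠ y → G.Adj u v → (u ∈ C ↔ v ∈ C) := by
    intro u v hu hv huv
    by_contra hne
    by_cases hu' : u ∈ C
    · exact hC u hu' v (by tauto) hv huv
    · exact hC v (by tauto) u hu' hu huv.symm
  have key : ∀ u v, u ≠ x → v ≠ x → u ≠ y → v ≠ y → ¬ (u ∈ A ↔ v ∈ A) → (u ∈ C ↔ v ∈ C) := by
    intro u v hux hvx huy hvy hne
    have huv : u ≠ v := by rintro rfl; exact hne Iff.rfl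
    exact hC' u v huy hvy ((hGH u v huv).2 fun h => hne (hA' u v hux hvx h))
  have h1 := hC' x w₁ hxy hw₁y hw₁
  have h2 := hA' y w₂ hxy.symm hw₂x hw₂
  -- a vertex other than `x` and `y` on the side of the separation `A` opposite to that of `y`
  obtain ⟨e, hex, hey, he⟩ : ∃ e, e ≠ x ∧ e ≠ y ∧ ¬ (e ∈ A ↔ w₂ ∈ A) := by
    by_cases hyA : y ∈ A
    · exact ⟨b, hbx, fun h => hb (h ▸ hyA), by tauto⟩
    · exact ⟨a, hax, fun h => hyA (h ▸ ha), by tauto⟩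
  have hall : ∀ v, v ≠ x → v ≠ y → (v ∈ C ↔ e ∈ C) := by
    intro v hvx hvy
    by_cases hv : v ∈ A ↔ w₂ ∈ A
    · exact key v e hvx hex hvy hey (by tauto)
    · rw [key v w₂ hvx hw₂x hvy hw₂y hv, key e w₂ hex hw₂x hey hw₂y he]
  have hall' : ∀ v, v ≠ y → (v ∈ C ↔ e ∈ C) := by
    intro v hvy
    by_cases hvx : v = x
    · rw [hvx, h1, hall w₁ hw₁x hw₁y]
    · exact hall v hvx hvy
  exact hd ((hall' d hdy).2 ((hall' c hcy).1 hc))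

/-- A graph on at least five vertices that is connected together with its complement has a vertex
whose deletion keeps both connected. -/
theorem exists_removable {V : Type*} [Finite V] {G H : SimpleGraph V}
    (hGH : Complementary G H) (hG : G.Connected) (hH : H.Connected) (hcard : 5 ≤ Nat.card V) :
    ∃ z, (G.induce {z}ᶜ).Connected ∧ (H.induce {z}ᶜ).Connected := by
  have : Nontrivial V := Finite.one_lt_card_iff_nontrivial.1 (by omega)
  obtain ⟨x, hx⟩ := hG.exists_connected_induce_compl_singleton_of_finite_nontrivial
  obtain ⟨y, hy⟩ := hH.exists_connected_induce_compl_singleton_of_finite_nontrivial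
  by_cases hHx : (H.induce {x}ᶜ).Connected
  · exact ⟨x, hx, hHx⟩
  by_cases hGy : (G.induce {y}ᶜ).Connected
  · exact ⟨y, hGy, hy⟩
  have hxy : x ≠ y := fun e => hHx (e ▸ hy)
  rcases pendant_or_pendant hGH hxy hHx hGy with h | h
  · exact exists_removable_of_pendant hGH hG hH hcard hxy h
  · obtain ⟨z, hz⟩ := exists_removable_of_pendant hGH.symm hH hG hcard hxy.symm h
    exact ⟨z, hz.symm⟩

/-! ### The upper bound -/

theorem ncard_pair_le {α : Type*} (a b : α) : ({a, b} : Set α).ncard ≤ 2 :=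
  (Set.ncard_insert_le a {b}).trans (by rw [Set.ncard_singleton])

theorem exists_adj_crossing {V : Type*} {G : SimpleGraph V} {x a b : V} {A : Set V}
    (h : (G.induce {x}ᶜ).Connected) (hax : a ≠ x) (ha : a ∈ A) (hbx : b ≠ x) (hb : b ∉ A) :
    ∃ u ∈ A, ∃ w, w ∉ A ∧ w ≠ x ∧ G.Adj u w := by
  obtain ⟨p⟩ := h.preconnected ⟨a, hax⟩ ⟨b, hbx⟩
  obtain ⟨d, -, hd₁, hd₂⟩ := p.exists_boundary_dart (Subtype.val ⁻¹' A) ha hb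
  exact ⟨d.fst, hd₁, d.snd, hd₂, d.snd.2, d.adj⟩

theorem exists_pendant_or_md_le {V : Type*} [Finite V] [Nontrivial V] {G : SimpleGraph V}
    (hG : G.Connected) {x : V} (hx : (G.induce {x}ᶜ).Connected) :
    (∃ y, G.Adj x y ∧ ∀ w, G.Adj x w → w = y) ∨ md G ≤ md (G.induce {x}ᶜ) := by
  obtain ⟨y, hy⟩ := hG.preconnected.exists_adj_of_nontrivial x
  by_cases hw : ∀ w, G.Adj x w → w = y
  · exact Or.inl ⟨y, hy, hw⟩
  · push Not at hw
    obtain ⟨w, hw, hwy⟩ := hw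
    exact Or.inr (md_le_md_induce hx hw hy hwy)

/-- On five vertices, if `x` is adjacent to all vertices but `p`, and `H - x` is connected, then
two colors suffice: that of `p w₁` and that of `x w₁`, for any neighbor `w₁` of `p`. Each of the
other colors is reduced to these by a triangle at `x` or a four-cycle through `x` and `p`. -/
theorem md_le_two_of_dominating {V : Type*} [Finite V] {H : SimpleGraph V}
    (hcard : Nat.card V = 5) {x p : V} (hxp : x ≠ p) (hdom : ∀ w, w ≠ x → w ≠ p → H.Adj x w)
    (hnot : ¬ H.Adj x p) (hconn : (H.induce {x}ᶜ).Connected) : md H ≤ 2 := by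
  obtain ⟨b, hb⟩ : ∃ b, b ∉ ({x, p} : Set V) := by
    by_contra! hcon
    have h2 := Set.ncard_le_ncard (fun v _ => hcon v : (Set.univ : Set V) ⊆ {x, p})
      (Set.toFinite _)
    have h3 := Set.ncard_insert_le x {p}
    rw [Set.ncard_univ] at h2
    rw [Set.ncard_singleton] at h3
    omega
  simp only [Set.mem_insert_iff, Set.mem_singleton_iff, not_or] at hb
  obtain ⟨u, hu, w₁, hw₁p, hw₁x, h₁⟩ :=
    exists_adj_crossing (A := {p}) hconn hxp.symm rfl hb.1 hb.2
  rw [Set.mem_singleton_iff] at hu hw₁p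
  obtain rfl := hu.symm
  have hW : ({x, p, w₁}ᶜ : Set V).ncard = 2 := by
    have h1 := Set.ncard_add_ncard_compl ({x, p, w₁} : Set V)
    have h2 : ({x, p, w₁} : Set V).ncard = 3 :=
      Set.ncard_eq_three.2 ⟨x, p, w₁, hxp, hw₁x.symm, h₁.ne, rfl⟩
    omega
  obtain ⟨w₂, w₃, h₂₃, hW⟩ := Set.ncard_eq_two.1 hW
  have hall : ∀ v, v ≠ x → v ≠ p → v = w₁ ∨ v = w₂ ∨ v = w₃ := by
    intro v hvx hvp
    by_cases hv : v = w₁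
    · exact Or.inl hv
    · have : v ∈ ({x, p, w₁}ᶜ : Set V) := by simp [hv, hvx, hvp]
      rw [hW] at this
      exact Or.inr this
  have hw₂ : w₂ ∈ ({x, p, w₁}ᶜ : Set V) := by simp [hW]
  have hw₃ : w₃ ∈ ({x, p, w₁}ᶜ : Set V) := by simp [hW]
  simp only [Set.mem_compl_iff, Set.mem_insert_iff, Set.mem_singleton_iff, not_or] at hw₂ hw₃
  obtain ⟨hw₂x, hw₂p, h₁₂⟩ := hw₂
  obtain ⟨hw₃x, hw₃p, h₁₃⟩ := hw₃
  refine md_le_of_forall fun Γ h => ?_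
  have tri : ∀ {v w}, v ≠ x → v ≠ p → w ≠ x → w ≠ p → H.Adj v w → Γ s(x, v) = Γ s(x, w) :=
    fun hvx hvp hwx hwp hvw => h.triangle (hdom _ hvx hvp) hvw (hdom _ hwx hwp)
  have four : ∀ {v w}, v ≠ x → w ≠ x → v ≠ w → H.Adj p v → H.Adj p w →
      Γ s(p, w) = Γ s(x, v) := fun hvx hwx hvw hv hw =>
    (h.four_cycle (hdom _ hvx hv.ne') hv.symm hw (hdom _ hwx hw.ne').symm hxp hvw).symm
  have f₂ : ¬ H.Adj p w₂ → Γ s(x, w₂) = Γ s(x, w₁) ∨ Γ s(x, w₂) = Γ s(x, w₃) := by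
    intro hn
    obtain ⟨v, rfl, w, hwv, hwx, hw⟩ :=
      exists_adj_crossing (A := {w₂}) hconn hw₂x rfl hw₁x (Ne.symm h₁₂)
    have hwp : w ≠ p := fun e => hn (e ▸ hw.symm)
    have := tri hw₂x hw₂p hwx hwp hw
    rcases hall w hwx hwp with rfl | rfl | rfl
    · exact Or.inl this
    · exact absurd rfl hwv
    · exact Or.inr this
  have f₃ : ¬ H.Adj p w₃ → Γ s(x, w₃) = Γ s(x, w₁) ∨ Γ s(x, w₃) = Γ s(x, w₂) := by
    intro hn
    obtain ⟨v, rfl, w, hwv, hwx, hw⟩ :=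
      exists_adj_crossing (A := {w₃}) hconn hw₃x rfl hw₁x (Ne.symm h₁₃)
    have hwp : w ≠ p := fun e => hn (e ▸ hw.symm)
    have := tri hw₃x hw₃p hwx hwp hw
    rcases hall w hwx hwp with rfl | rfl | rfl
    · exact Or.inl this
    · exact Or.inr this
    · exact absurd rfl hwv
  have f₁ : ¬ H.Adj p w₂ → ¬ H.Adj p w₃ →
      Γ s(x, w₁) = Γ s(x, w₂) ∨ Γ s(x, w₁) = Γ s(x, w₃) := by
    intro hn₂ hn₃
    obtain ⟨v, hv, w, hwv, hwx, hw⟩ :=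
      exists_adj_crossing (A := {p, w₁}) (b := w₂) hconn hw₁x (by simp) hw₂x
        (by simp [hw₂p, h₁₂])
    simp only [Set.mem_insert_iff, Set.mem_singleton_iff, not_or] at hv hwv
    have hw' : w = w₂ ∨ w = w₃ := (hall w hwx hwv.1).resolve_left hwv.2
    have hv' : v = w₁ := by
      refine hv.resolve_left ?_
      rintro rfl
      rcases hw' with rfl | rfl
      · exact hn₂ hw
      · exact hn₃ hw
    subst hv'
    have := tri hw₁x hw₁p hwx hwv.1 hw
    rcases hw' with rfl | rfl
    · exact Or.inl this
    · exact Or.inr this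
  have hx : ∀ w, w ≠ x → w ≠ p → Γ s(x, w) = Γ s(p, w₁) ∨ Γ s(x, w) = Γ s(x, w₁) := by
    have g₂ : H.Adj p w₂ → Γ s(p, w₁) = Γ s(x, w₂) := fun hp =>
      four hw₂x hw₁x h₁₂ hp h₁
    have g₃ : H.Adj p w₃ → Γ s(p, w₁) = Γ s(x, w₃) := fun hp =>
      four hw₃x hw₁x h₁₃ hp h₁
    intro w hwx hwp
    rcases hall w hwx hwp with rfl | rfl | rfl
    · exact Or.inr rfl
    all_goals
      clear hall four tri hdom hconn hW
      grind
  have hp : ∀ w, H.Adj p w → Γ s(p, w) = Γ s(p, w₁) ∨ Γ s(p, w) = Γ s(x, w₁) := by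
    intro w hw
    by_cases hw₁ : w = w₁
    · exact Or.inl (by rw [hw₁])
    · exact Or.inr (four hw₁x (fun e => hnot (e ▸ hw.symm)) (Ne.symm hw₁) h₁ hw)
  have hsub : Γ '' H.edgeSet ⊆ {Γ s(p, w₁), Γ s(x, w₁)} := by
    rintro _ ⟨e, he, rfl⟩
    induction e with | _ a b
    have hab : H.Adj a b := he
    by_cases hap : a = p
    · exact hap ▸ hp b (hap ▸ hab)
    by_cases hbp : b = p
    · exact Sym2.eq_swap (a := a) ▸ hbp ▸ hp a (hbp ▸ hab.symm)
    by_cases hax : a = x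
    · subst hax
      exact hx b hab.ne' hbp
    by_cases hbx : b = x
    · subst hbx
      exact Sym2.eq_swap (a := a) ▸ hx a hab.ne hap
    · have : Γ s(a, b) = Γ s(x, a) := by
        rw [Sym2.eq_swap (a := x)]
        exact h.triangle hab (hdom b hbx hbp).symm (hdom a hax hap).symm
      rw [this]
      exact hx a hax hap
  exact (Set.ncard_le_ncard hsub (Set.toFinite _)).trans (ncard_pair_le _ _)

theorem md_compl_le_two_of_pendant {V : Type*} [Finite V] {G H : SimpleGraph V}
    (hGH : Complementary G H) (hcard : Nat.card V = 5) {x p : V} (hxp : G.Adj x p)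
    (hpend : ∀ w, G.Adj x w → w = p) (hconn : (H.induce {x}ᶜ).Connected) : md H ≤ 2 :=
  md_le_two_of_dominating hcard hxp.ne
    (fun w hwx hwp => (hGH.symm x w hwx.symm).2 fun h => hwp (hpend w h))
    ((hGH x p hxp.ne).1 hxp) hconn

theorem card_compl_singleton {V : Type*} [Finite V] (x : V) :
    Nat.card ({x}ᶜ : Set V) + 1 = Nat.card V := by
  have := Set.ncard_add_ncard_compl ({x} : Set V)
  rw [Set.ncard_singleton] at this
  rw [Nat.card_coe_set_eq]
  omega

/-- Deleting a vertex that keeps both graphs connected lowers `md G + md H` by at most one, since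
the vertex cannot be pendant in both. From five vertices the deletion leads to graphs on four
vertices, on which each term is at most three; that settles the case without a pendant vertex. -/
theorem md_add_md_le {V : Type*} [Finite V] {G H : SimpleGraph V}
    (hGH : Complementary G H) (hG : G.Connected) (hH : H.Connected) {n : ℕ} (hn : 5 ≤ n)
    (hcard : Nat.card V = n) : md G + md H ≤ n + 1 := by
  induction n, hn using Nat.le_induction generalizing V with
  | base =>
    have : Nontrivial V := Finite.one_lt_card_iff_nontrivial.1 (by omega)
    obtain ⟨z, hGz, hHz⟩ := exists_removable hGH hG hH hcard.ge
    have hz := card_compl_singleton z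
    have h₁ := md_add_one_le_card hG
    have h₂ := md_add_one_le_card hH
    have h₃ := md_add_one_le_card hGz
    have h₄ := md_add_one_le_card hHz
    rcases exists_pendant_or_md_le hG hGz with ⟨p, hp, hp'⟩ | hpG
    · have := md_compl_le_two_of_pendant hGH hcard hp hp' hHz
      omega
    rcases exists_pendant_or_md_le hH hHz with ⟨p, hp, hp'⟩ | hpH
    · have := md_compl_le_two_of_pendant hGH.symm hcard hp hp' hGz
      omega
    omega
  | succ n hn ih =>
    have : Nontrivial V := Finite.one_lt_card_iff_nontrivial.1 (by omega)
    obtain ⟨z, hGz, hHz⟩ := exists_removable hGH hG hH (by omega)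
    have hz := card_compl_singleton z
    have hsum := ih (hGH.induce _) hGz hHz (by omega)
    rcases exists_pendant_or_md_le hG hGz with ⟨p, hp, hp'⟩ | hpG
    · rcases exists_pendant_or_md_le hH hHz with ⟨q, hq, hq'⟩ | hpH
      · -- `z` would have only the two neighbors `p` and `q`
        have hle := Set.ncard_le_ncard (s := {z}ᶜ) (t := {p, q}) (fun w hw => by
          by_cases hzw : G.Adj z w
          · exact Or.inl (hp' w hzw)
          · exact Or.inr (hq' w ((hGH.symm z w (Ne.symm hw)).2 hzw))) (Set.toFinite _)
        have h2 := ncard_pair_le p q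
        rw [Nat.card_coe_set_eq] at hz
        omega
      · have := md_le_md_induce_add_one hp'
        omega
    · rcases exists_pendant_or_md_le hH hHz with ⟨q, hq, hq'⟩ | hpH
      · have := md_le_md_induce_add_one hq'
        omega
      · omega

/-! ### Trees of maximum degree `n - 2` -/

theorem eq_of_reachable_of_isolated {V : Type*} {G : SimpleGraph V} {u v : V}
    (hu : ∀ w, ¬ G.Adj u w) (h : G.Reachable u v) : u = v := by
  obtain ⟨p⟩ := h
  cases p with
  | nil => rfl
  | cons h _ => exact absurd h (hu _)

/-- In a tree all edges may receive different colors. -/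
theorem SimpleGraph.IsTree.card_le_md_add_one {V : Type*} [Finite V] {G : SimpleGraph V} (hG : G.IsTree) :
    Nat.card V ≤ md G + 1 := by
  obtain ⟨Γ, hΓ⟩ := exists_injective_nat (Sym2 V)
  have h : IsMDColoring G Γ := by
    refine isMDColoring_of_exists_color fun u v huv => ?_
    obtain ⟨p, hp⟩ := hG.connected.exists_isPath u v
    have hnil : ¬ p.Nil := Walk.not_nil_of_ne huv
    refine ⟨Γ s(u, p.snd), fun hr => ?_⟩
    obtain ⟨q, hq⟩ := hr.exists_isPath
    have := hG.isAcyclic.subsingleton_path u v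
    have heq : p = q.mapLe (deleteEdges_le _) := Subtype.mk.inj
      (Subsingleton.elim (⟨p, hp⟩ : G.Path u v)
        ⟨q.mapLe (deleteEdges_le _), hq.mapLe (deleteEdges_le _)⟩)
    have hmem : s(u, p.snd) ∈ p.edges := p.mk_start_snd_mem_edges hnil
    have hq' : p.edges = q.edges := by
      conv_lhs => rw [heq]
      exact Walk.edges_mapLe_eq_edges _ _
    rw [hq'] at hmem
    simpa using q.edges_subset_edgeSet hmem
  have := ncard_image_le_md h
  rw [Set.ncard_image_of_injective _ hΓ] at this
  have hcard := (isTree_iff_connected_and_card.1 hG).2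
  rw [Nat.card_coe_set_eq] at hcard
  omega

/-- A pendant edge may have a color of its own. -/
theorem two_le_md_of_pendant {V : Type*} [Finite V] {G : SimpleGraph V} (hG : G.Connected)
    (hcard : 3 ≤ Nat.card V) {x y : V} (hxy : G.Adj x y) (hpend : ∀ w, G.Adj x w → w = y) :
    2 ≤ md G := by
  classical
  have : Nontrivial V := ⟨x, y, hxy.ne⟩
  let Γ : Sym2 V → ℕ := fun e => if e = s(x, y) then 1 else 0
  have hx : ∀ w, ¬ (G.deleteEdges {e | Γ e = 1}).Adj x w := by
    intro w hw
    rw [deleteEdges_adj] at hw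
    obtain rfl := hpend w hw.1
    exact hw.2 (by simp [Γ])
  have h : IsMDColoring G Γ := by
    refine isMDColoring_of_exists_color fun u v huv => ?_
    by_cases hu : u = x
    · exact ⟨1, fun hr => huv (eq_of_reachable_of_isolated (hu ▸ hx) hr)⟩
    by_cases hv : v = x
    · exact ⟨1, fun hr => huv.symm (eq_of_reachable_of_isolated (hv ▸ hx) hr.symm)⟩
    have hiso : ∀ w, w ≠ x → w ≠ y → ∀ t, ¬ (G.deleteEdges {e | Γ e = 0}).Adj w t := by
      intro w hwx hwy t hwt
      rw [deleteEdges_adj] at hwt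
      exact hwt.2 (by simp [Γ, hwx, hwy])
    refine ⟨0, fun hr => ?_⟩
    by_cases huy : u = y
    · exact huv.symm (eq_of_reachable_of_isolated (hiso v hv (huy ▸ huv.symm)) hr.symm)
    · exact huv (eq_of_reachable_of_isolated (hiso u hu huy) hr)
  obtain ⟨z, hz⟩ : ∃ z, z ∉ ({x, y} : Set V) := by
    by_contra! hcon
    have h2 := Set.ncard_le_ncard (fun v _ => hcon v : (Set.univ : Set V) ⊆ {x, y})
      (Set.toFinite _)
    have h3 := ncard_pair_le x y
    rw [Set.ncard_univ] at h2
    omega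
  simp only [Set.mem_insert_iff, Set.mem_singleton_iff, not_or] at hz
  obtain ⟨w, hw⟩ := hG.preconnected.exists_adj_of_nontrivial z
  refine le_trans ?_ (ncard_image_le_md h)
  rw [← Set.ncard_pair (zero_ne_one (α := ℕ))]
  refine Set.ncard_le_ncard ?_ (Set.toFinite _)
  rintro i (rfl | rfl)
  · exact ⟨s(z, w), hw, by simp [Γ, hz]⟩
  · exact ⟨s(x, y), hxy, by simp [Γ]⟩

theorem SimpleGraph.IsAcyclic.not_adj_of_adj_adj {V : Type*} {G : SimpleGraph V} (hG : G.IsAcyclic)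
    {a b c : V} (hab : G.Adj a b) (hac : G.Adj a c) : ¬ G.Adj b c := by
  intro hbc
  have := hG.subsingleton_path a c
  have := Subsingleton.elim (⟨.cons hac .nil, by simp [hac.ne]⟩ : G.Path a c)
    ⟨.cons hab (.cons hbc .nil), by simp [hac.ne, hbc.ne, hab.ne]⟩
  simpa using congrArg Walk.length (Subtype.mk.inj this)

theorem SimpleGraph.IsAcyclic.eq_of_common_neighbors {V : Type*} {G : SimpleGraph V} (hG : G.IsAcyclic)
    {a b c d : V} (hab : G.Adj a b) (hbc : G.Adj b c) (had : G.Adj a d) (hdc : G.Adj d c)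
    (hac : a ≠ c) : b = d := by
  have := hG.subsingleton_path a c
  have := Subsingleton.elim
    (⟨.cons hab (.cons hbc .nil), by simp [hab.ne, hbc.ne, hac]⟩ : G.Path a c)
    ⟨.cons had (.cons hdc .nil), by simp [had.ne, hdc.ne, hac]⟩
  simpa using congrArg Walk.snd (Subtype.mk.inj this)

/-- A vertex of degree `n - 2` is adjacent to all others but one. -/
theorem exists_unique_nonneighbor {V : Type*} [Fintype V] {G : SimpleGraph V}
    [DecidableRel G.Adj] {v : V} (hv : G.degree v + 2 = Fintype.card V) :
    ∃ w, w ≠ v ∧ ¬ G.Adj v w ∧ ∀ t, t ≠ v → t ≠ w → G.Adj v t := by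
  classical
  have h : (insert v (G.neighborFinset v))ᶜ.card = 1 := by
    rw [Finset.card_compl, Finset.card_insert_of_notMem (by simp), card_neighborFinset_eq_degree]
    omega
  obtain ⟨w, hw⟩ := Finset.card_eq_one.1 h
  have hmem : ∀ t, t = w ↔ t ≠ v ∧ ¬ G.Adj v t := fun t => by
    rw [← Finset.mem_singleton, ← hw]
    simp
  refine ⟨w, ((hmem w).1 rfl).1, ((hmem w).1 rfl).2, fun t htv htw => ?_⟩
  by_contra hvt
  exact htw ((hmem t).2 ⟨htv, hvt⟩)

/-- Let `v` be adjacent in the tree `G` to all vertices but `w`. Then `w` has at most one neighbor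
`u`, since `v` and `w` have at most one common neighbor, and in the complement `u` is joined to
`w` through any fourth neighbor of `v`. -/
theorem SimpleGraph.IsAcyclic.connected_compl {V : Type*} [Finite V] {G : SimpleGraph V} (hG : G.IsAcyclic)
    (hcard : 4 ≤ Nat.card V) {v w : V} (hwv : w ≠ v) (hvw : ¬ G.Adj v w)
    (hv : ∀ t, t ≠ v → t ≠ w → G.Adj v t) : Gᶜ.Connected := by
  refine connected_iff_exists_forall_reachable _ |>.2 ⟨w, fun u => ?_⟩
  by_cases huw : u = w
  · exact huw ▸ .rfl
  by_cases hwu : G.Adj w u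
  · have huv : u ≠ v := by
      rintro rfl
      exact hvw hwu.symm
    obtain ⟨s, hs⟩ : ∃ s, s ∉ ({u, v, w} : Set V) := by
      by_contra! hcon
      have h1 := Set.ncard_le_ncard (fun v _ => hcon v : (Set.univ : Set V) ⊆ {u, v, w})
        (Set.toFinite _)
      have h2 := Set.ncard_insert_le u {v, w}
      have h3 := ncard_pair_le v w
      rw [Set.ncard_univ] at h1
      omega
    simp only [Set.mem_insert_iff, Set.mem_singleton_iff, not_or] at hs
    obtain ⟨hsu, hsv, hsw⟩ := hs
    have hvu := hv u huv huw
    have hvs := hv s hsv hsw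
    refine (Adj.reachable (v := s) ?_).trans (Adj.reachable ?_)
    · refine ⟨Ne.symm hsw, fun hws => hsu ?_⟩
      exact hG.eq_of_common_neighbors hvs hws.symm hvu hwu.symm hwv.symm
    · exact ⟨hsu, hG.not_adj_of_adj_adj hvs hvu⟩
  · exact Adj.reachable ⟨Ne.symm huw, hwu⟩

theorem SimpleGraph.IsTree.connected_compl_and_md_add_md {V : Type*} [Fintype V] {G : SimpleGraph V}
    [DecidableRel G.Adj] (hcard : 5 ≤ Fintype.card V) (hG : G.IsTree)
    (hdeg : G.maxDegree + 2 = Fintype.card V) :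
    Gᶜ.Connected ∧ md G + md Gᶜ = Fintype.card V + 1 := by
  have hne := hG.connected.nonempty
  obtain ⟨v, hv⟩ := G.exists_maximal_degree_vertex
  obtain ⟨w, hwv, hvw, hall⟩ := exists_unique_nonneighbor (hv ▸ hdeg)
  rw [← Nat.card_eq_fintype_card] at hcard ⊢
  have hc : Gᶜ.Connected :=
    hG.isAcyclic.connected_compl (by omega) hwv hvw hall
  refine ⟨hc, le_antisymm
    (md_add_md_le (complementary_compl G) hG.connected hc hcard rfl) ?_⟩
  have h₁ := hG.card_le_md_add_one
  have h₂ : 2 ≤ md Gᶜ := by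
    refine two_le_md_of_pendant hc (by omega) (x := v) (y := w) ⟨hwv.symm, hvw⟩ fun t ht => ?_
    by_contra htw
    exact ht.2 (hall t ht.ne' htw)
  omega

/-- The tree on `n` vertices consisting of a star with center `0` and leaves `1, …, n - 2`,
together with the pendant vertex `n - 1` attached to the leaf `1`. -/
def extendedStar (n : ℕ) : SimpleGraph (Fin n) :=
  .fromRel fun i j => (i.val = 0 ∧ j.val + 1 < n) ∨ (i.val = 1 ∧ j.val + 1 = n)

theorem extendedStar_adj {n : ℕ} {i j : Fin n} : (extendedStar n).Adj i j ↔ i ≠ j ∧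
    (((i.val = 0 ∧ j.val + 1 < n) ∨ (i.val = 1 ∧ j.val + 1 = n)) ∨
      ((j.val = 0 ∧ i.val + 1 < n) ∨ (j.val = 1 ∧ i.val + 1 = n))) :=
  Iff.rfl

theorem extendedStar_connected {n : ℕ} (hn : 5 ≤ n) : (extendedStar n).Connected := by
  refine connected_iff_exists_forall_reachable _ |>.2 ⟨⟨0, by omega⟩, fun i => ?_⟩
  by_cases h0 : i.val = 0
  · rw [show i = ⟨0, by omega⟩ from Fin.ext h0]
  by_cases hi : i.val + 1 = n
  · refine (Adj.reachable (v := ⟨1, by omega⟩) ?_).trans (Adj.reachable ?_) <;>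
      simp only [extendedStar_adj, ne_eq, Fin.ext_iff, true_and] <;> omega
  · refine Adj.reachable ?_
    simp only [extendedStar_adj, ne_eq, Fin.ext_iff, true_and]
    omega

theorem extendedStar_isTree {n : ℕ} (hn : 5 ≤ n) : (extendedStar n).IsTree := by
  have hc := extendedStar_connected hn
  refine isTree_iff_connected_and_card.2 ⟨hc, le_antisymm ?_ hc.card_vert_le_card_edgeSet_add_one⟩
  -- each edge is determined by its end farther from `0`
  have hsub : (extendedStar n).edgeSet ⊆
      (fun k : Fin n => s(k, if k.val + 1 = n then ⟨1, by omega⟩ else ⟨0, by omega⟩)) ''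
        {⟨0, by omega⟩}ᶜ := by
    intro e he
    induction e with | _ i j
    have hij := extendedStar_adj.1 he
    simp only [ne_eq, Fin.ext_iff] at hij
    simp only [Set.mem_image, Set.mem_compl_iff, Set.mem_singleton_iff, Fin.ext_iff, Sym2.eq_iff]
    by_cases h : (j.val = 0 ∧ i.val + 1 < n) ∨ (j.val = 1 ∧ i.val + 1 = n)
    · refine ⟨i, by omega, Or.inl ⟨rfl, ?_⟩⟩
      split_ifs <;> simp only <;> omega
    · refine ⟨j, by omega, Or.inr ⟨rfl, ?_⟩⟩
      split_ifs <;> simp only <;> omega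
  have h1 := (Set.ncard_le_ncard hsub (Set.toFinite _)).trans (Set.ncard_image_le (Set.toFinite _))
  have h2 := card_compl_singleton (⟨0, by omega⟩ : Fin n)
  rw [Nat.card_coe_set_eq] at h2 ⊢
  omega

theorem extendedStar_maxDegree {n : ℕ} (hn : 5 ≤ n) [DecidableRel (extendedStar n).Adj] :
    (extendedStar n).maxDegree + 2 = n := by
  have hpair : ∀ i j : Fin n, i ≠ j → ({i, j}ᶜ : Finset (Fin n)).card + 2 = n := by
    intro i j hij
    rw [Finset.card_compl, Finset.card_pair hij, Fintype.card_fin]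
    omega
  have hle : (extendedStar n).maxDegree ≤ n - 2 := by
    refine maxDegree_le_of_forall_degree_le _ _ fun i => ?_
    obtain ⟨j, hij, hadj⟩ : ∃ j, i ≠ j ∧ ¬ (extendedStar n).Adj i j := by
      simp only [extendedStar_adj, ne_eq, Fin.ext_iff]
      by_cases h0 : i.val = 0
      · exact ⟨⟨n - 1, by omega⟩, by simp only; omega, by simp only; omega⟩
      by_cases h1 : i.val + 1 = n
      · exact ⟨⟨0, by omega⟩, by simp only; omega, by simp only; omega⟩
      by_cases h2 : i.val = 1
      · exact ⟨⟨2, by omega⟩, by simp only; omega, by simp only; omega⟩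
      · exact ⟨⟨1, by omega⟩, by simp only; omega, by simp only; omega⟩
    have hsub : (extendedStar n).neighborFinset i ⊆ {i, j}ᶜ := by
      intro k hk
      rw [mem_neighborFinset] at hk
      simp only [Finset.mem_compl, Finset.mem_insert, Finset.mem_singleton, not_or]
      exact ⟨hk.ne', fun e => hadj (e ▸ hk)⟩
    have := Finset.card_le_card hsub
    have := hpair i j hij
    rw [card_neighborFinset_eq_degree] at *
    omega
  have hge : ({⟨0, by omega⟩, ⟨n - 1, by omega⟩}ᶜ : Finset (Fin n)).card ≤
      (extendedStar n).maxDegree := by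
    refine le_trans ?_ ((extendedStar n).degree_le_maxDegree ⟨0, by omega⟩)
    rw [← card_neighborFinset_eq_degree]
    refine Finset.card_le_card fun k hk => ?_
    simp only [Finset.mem_compl, Finset.mem_insert, Finset.mem_singleton, not_or,
      Fin.ext_iff] at hk
    rw [mem_neighborFinset, extendedStar_adj]
    simp only [ne_eq, Fin.ext_iff, true_and]
    omega
  have := hpair ⟨0, by omega⟩ ⟨n - 1, by omega⟩ (by simp only [ne_eq, Fin.ext_iff]; omega)
  omega

/-! ### Bipartite graphs attaining the lower bound -/

theorem md_eq_one_of_forall {V : Type*} [Finite V] [Nontrivial V] {G : SimpleGraph V}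
    (hG : G.Connected)
    (h : ∀ Γ, IsMDColoring G Γ → ∃ c, ∀ a b, G.Adj a b → Γ s(a, b) = c) : md G = 1 := by
  refine le_antisymm (md_le_of_forall fun Γ hΓ => ?_) (one_le_md hG)
  obtain ⟨c, hc⟩ := h Γ hΓ
  rw [← Set.ncard_singleton c]
  refine Set.ncard_le_ncard ?_ (Set.toFinite _)
  rintro _ ⟨e, he, rfl⟩
  induction e with | _ a b
  exact hc a b he

/-- The complete bipartite graph with parts `{0, 1, 2, 3}` and `{4, …, n - 1}` with the edges of
the path `5, 0, 4, 1` removed. -/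
def bipartiteMinusPath (n : ℕ) : SimpleGraph (Fin n) :=
  .fromRel fun i j => i.val < 4 ∧ 4 ≤ j.val ∧
    ¬ (i.val = 0 ∧ j.val = 4) ∧ ¬ (i.val = 0 ∧ j.val = 5) ∧ ¬ (i.val = 1 ∧ j.val = 4)

theorem bipartiteMinusPath_adj {n : ℕ} {i j : Fin n} (hi : i.val < 4) :
    (bipartiteMinusPath n).Adj i j ↔ 4 ≤ j.val ∧
      ¬ (i.val = 0 ∧ j.val = 4) ∧ ¬ (i.val = 0 ∧ j.val = 5) ∧ ¬ (i.val = 1 ∧ j.val = 4) := by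
  simp only [bipartiteMinusPath, fromRel_adj, ne_eq, Fin.ext_iff]
  omega

theorem bipartiteMinusPath_adj_of_le {n : ℕ} {i j : Fin n} (hi : 4 ≤ i.val) :
    (bipartiteMinusPath n).Adj i j ↔ j.val < 4 ∧
      ¬ (j.val = 0 ∧ i.val = 4) ∧ ¬ (j.val = 0 ∧ i.val = 5) ∧ ¬ (j.val = 1 ∧ i.val = 4) := by
  simp only [bipartiteMinusPath, fromRel_adj, ne_eq, Fin.ext_iff]
  omega

theorem bipartiteMinusPath_isBipartite (n : ℕ) : (bipartiteMinusPath n).IsBipartite := by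
  refine ⟨Coloring.mk (fun i => if i.val < 4 then 0 else 1) ?_⟩
  intro i j hij
  by_cases hi : i.val < 4
  · have := (bipartiteMinusPath_adj hi).1 hij
    simp [hi, show ¬ j.val < 4 by omega]
  · have := (bipartiteMinusPath_adj_of_le (not_lt.1 hi)).1 hij
    simp [hi, show j.val < 4 by omega]

theorem bipartiteMinusPath_connected {n : ℕ} (hn : 8 ≤ n) :
    (bipartiteMinusPath n).Connected := by
  refine connected_iff_exists_forall_reachable _ |>.2 ⟨⟨2, by omega⟩, fun i => ?_⟩
  by_cases hi : i.val < 4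
  · refine (Adj.reachable (v := ⟨6, by omega⟩) ?_).trans (Adj.reachable ?_)
    · rw [bipartiteMinusPath_adj (by simp)]
      simp
    · rw [bipartiteMinusPath_adj_of_le (by simp)]
      simp only
      omega
  · refine Adj.reachable ?_
    rw [bipartiteMinusPath_adj (by simp)]
    simp only
    omega

theorem compl_bipartiteMinusPath_adj {n : ℕ} {i j : Fin n} : (bipartiteMinusPath n)ᶜ.Adj i j ↔
    i.val ≠ j.val ∧ ((i.val < 4 ↔ j.val < 4) ∨
      (i.val = 0 ∧ (j.val = 4 ∨ j.val = 5)) ∨ (i.val = 1 ∧ j.val = 4) ∨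
      (j.val = 0 ∧ (i.val = 4 ∨ i.val = 5)) ∨ (j.val = 1 ∧ i.val = 4)) := by
  simp only [bipartiteMinusPath, compl_adj, fromRel_adj, ne_eq, Fin.ext_iff]
  omega

theorem compl_bipartiteMinusPath_connected {n : ℕ} (hn : 8 ≤ n) :
    (bipartiteMinusPath n)ᶜ.Connected := by
  obtain ⟨a, ha⟩ : ∃ a : Fin n, a.val = 0 := ⟨⟨0, by omega⟩, rfl⟩
  obtain ⟨b, hb⟩ : ∃ b : Fin n, b.val = 4 := ⟨⟨4, by omega⟩, rfl⟩
  refine connected_iff_exists_forall_reachable _ |>.2 ⟨a, fun i => ?_⟩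
  by_cases hia : i = a
  · rw [hia]
  rw [Fin.ext_iff] at hia
  by_cases hi : i.val ≤ 4
  · refine Adj.reachable ?_
    rw [compl_bipartiteMinusPath_adj]
    omega
  · refine (Adj.reachable (v := b) ?_).trans (Adj.reachable ?_) <;>
      rw [compl_bipartiteMinusPath_adj] <;> omega

/-- The vertices `2` and `3` are adjacent to at least three common neighbors, so all edges at them
have one color. Every other edge `i j` with `i < 4` lies in a four-cycle through `2` and a
second neighbor `k` of `i`, in which it is opposite to the edge `2 k`. -/
theorem md_bipartiteMinusPath {n : ℕ} (hn : 8 ≤ n) : md (bipartiteMinusPath n) = 1 := by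
  have : Nontrivial (Fin n) := Fin.nontrivial_iff_two_le.2 (by omega)
  refine md_eq_one_of_forall (bipartiteMinusPath_connected hn) fun Γ h => ?_
  obtain ⟨a, ha⟩ : ∃ a : Fin n, a.val = 2 := ⟨⟨2, by omega⟩, rfl⟩
  obtain ⟨b, hb⟩ : ∃ b : Fin n, b.val = 3 := ⟨⟨3, by omega⟩, rfl⟩
  obtain ⟨p, hp⟩ : ∃ p : Fin n, p.val = 6 := ⟨⟨6, by omega⟩, rfl⟩
  have hadj : ∀ j : Fin n, 4 ≤ j.val →
      (bipartiteMinusPath n).Adj a j ∧ (bipartiteMinusPath n).Adj b j := by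
    intro j hj
    rw [bipartiteMinusPath_adj (by omega), bipartiteMinusPath_adj (by omega)]
    omega
  have four : ∀ i j k : Fin n, i.val < 4 → i ≠ a → j ≠ k → (bipartiteMinusPath n).Adj i j →
      (bipartiteMinusPath n).Adj i k → Γ s(i, j) = Γ s(a, k) := by
    intro i j k hi hia hjk hij hik
    have hj := ((bipartiteMinusPath_adj hi).1 hij).1
    have hk := ((bipartiteMinusPath_adj hi).1 hik).1
    exact h.four_cycle hij (hadj j hj).1.symm (hadj k hk).1 hik.symm hia hjk
  have hab : ∀ j k : Fin n, 4 ≤ j.val → 4 ≤ k.val → j ≠ k → Γ s(b, j) = Γ s(a, k) :=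
    fun j k hj hk hjk => four b j k (by omega) (Fin.val_ne_iff.1 (by omega)) hjk (hadj j hj).2
      (hadj k hk).2
  have ha' : ∀ j : Fin n, 4 ≤ j.val → Γ s(a, j) = Γ s(a, p) := by
    intro j hj
    obtain ⟨k, hk, hkj, hkp⟩ : ∃ k : Fin n, 4 ≤ k.val ∧ k.val ≠ j.val ∧ k.val ≠ p.val := by
      by_cases h4 : j.val = 4
      · exact ⟨⟨5, by omega⟩, by simp, by simp [h4], by simp [hp]⟩
      · exact ⟨⟨4, by omega⟩, by simp, Ne.symm h4, by simp [hp]⟩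
    rw [← hab k j hk hj (Fin.val_ne_iff.1 hkj), hab k p hk (by omega) (Fin.val_ne_iff.1 hkp)]
  have main : ∀ i j : Fin n, i.val < 4 → (bipartiteMinusPath n).Adj i j →
      Γ s(i, j) = Γ s(a, p) := by
    intro i j hi hij
    have hj := ((bipartiteMinusPath_adj hi).1 hij).1
    by_cases hia : i = a
    · rw [hia, ha' j hj]
    obtain ⟨k, hk, hkj⟩ : ∃ k : Fin n, 6 ≤ k.val ∧ j.val ≠ k.val := by
      by_cases h6 : j.val = 6
      · exact ⟨⟨7, by omega⟩, by simp, by simp [h6]⟩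
      · exact ⟨⟨6, by omega⟩, by simp, h6⟩
    rw [four i j k hi hia (Fin.val_ne_iff.1 hkj) hij
      ((bipartiteMinusPath_adj hi).2 (by omega)), ha' k (by omega)]
  refine ⟨Γ s(a, p), fun i j hij => ?_⟩
  by_cases hi : i.val < 4
  · exact main i j hi hij
  · have hj := ((bipartiteMinusPath_adj_of_le (not_lt.1 hi)).1 hij).1
    rw [Sym2.eq_swap]
    exact main j i hj hij.symm

/-- Each part is a clique in the complement. The triangles `0 1 4` and `0 4 5` share the edge `0 4`
with each other and an edge with one of the two cliques, so that there is only one color. -/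
theorem md_compl_bipartiteMinusPath {n : ℕ} (hn : 8 ≤ n) : md (bipartiteMinusPath n)ᶜ = 1 := by
  have : Nontrivial (Fin n) := Fin.nontrivial_iff_two_le.2 (by omega)
  refine md_eq_one_of_forall (compl_bipartiteMinusPath_connected hn) fun Γ h => ?_
  obtain ⟨a, ha⟩ : ∃ a : Fin n, a.val = 0 := ⟨⟨0, by omega⟩, rfl⟩
  obtain ⟨b, hb⟩ : ∃ b : Fin n, b.val = 4 := ⟨⟨4, by omega⟩, rfl⟩
  obtain ⟨p, hp⟩ : ∃ p : Fin n, p.val = 1 := ⟨⟨1, by omega⟩, rfl⟩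
  obtain ⟨q, hq⟩ : ∃ q : Fin n, q.val = 5 := ⟨⟨5, by omega⟩, rfl⟩
  have tri : ∀ i j k : Fin n, (bipartiteMinusPath n)ᶜ.Adj i j → (bipartiteMinusPath n)ᶜ.Adj j k →
      (bipartiteMinusPath n)ᶜ.Adj i k → Γ s(i, j) = Γ s(i, k) := fun i j k => h.triangle
  have hap : Γ s(a, p) = Γ s(a, b) := by
    apply tri <;> rw [compl_bipartiteMinusPath_adj] <;> omega
  have haq : Γ s(a, q) = Γ s(a, b) := by
    apply tri <;> rw [compl_bipartiteMinusPath_adj] <;> omega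
  have hbp : Γ s(b, p) = Γ s(a, b) := by
    rw [Sym2.eq_swap (a := a)]
    apply tri <;> rw [compl_bipartiteMinusPath_adj] <;> omega
  have hbq : Γ s(b, q) = Γ s(a, b) := by
    rw [Sym2.eq_swap (a := a)]
    apply tri <;> rw [compl_bipartiteMinusPath_adj] <;> omega
  have hA : ∀ i : Fin n, i ≠ a → i.val < 4 → Γ s(a, i) = Γ s(a, b) := by
    intro i hia h4
    rw [ne_eq, Fin.ext_iff] at hia
    by_cases hi : i = p
    · rw [hi, hap]
    rw [Fin.ext_iff] at hi
    rw [← hap]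
    apply tri <;> rw [compl_bipartiteMinusPath_adj] <;> omega
  have hB : ∀ i : Fin n, i ≠ b → 4 ≤ i.val → Γ s(b, i) = Γ s(a, b) := by
    intro i hib h4
    rw [ne_eq, Fin.ext_iff] at hib
    by_cases hi : i = q
    · rw [hi, hbq]
    rw [Fin.ext_iff] at hi
    rw [← hbq]
    apply tri <;> rw [compl_bipartiteMinusPath_adj] <;> omega
  have main : ∀ i j : Fin n, i.val < j.val → (bipartiteMinusPath n)ᶜ.Adj i j →
      Γ s(i, j) = Γ s(a, b) := by
    intro i j hlt hij
    have hij' := compl_bipartiteMinusPath_adj.1 hij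
    by_cases hj : j.val < 4
    · by_cases hia : i = a
      · rw [hia, hA j (Fin.val_ne_iff.1 (by omega)) hj]
      have hia' := Fin.val_ne_iff.2 hia
      rw [← hA i hia (by omega), Sym2.eq_swap (a := a)]
      apply tri <;> rw [compl_bipartiteMinusPath_adj] <;> omega
    by_cases hi : 4 ≤ i.val
    · by_cases hib : i = b
      · rw [hib, hB j (Fin.val_ne_iff.1 (by omega)) (by omega)]
      have hib' := Fin.val_ne_iff.2 hib
      rw [← hB i hib hi, Sym2.eq_swap (a := b)]
      apply tri <;> rw [compl_bipartiteMinusPath_adj] <;> omega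
    by_cases hia : i = a
    · by_cases hjb : j = b
      · rw [hia, hjb]
      have hjb' := Fin.val_ne_iff.2 hjb
      rw [hia, show j = q from Fin.ext (by omega), haq]
    have hia' := Fin.val_ne_iff.2 hia
    rw [show i = p from Fin.ext (by omega), show j = b from Fin.ext (by omega), Sym2.eq_swap, hbp]
  refine ⟨Γ s(a, b), fun i j hij => ?_⟩
  rcases Nat.lt_or_gt_of_ne (compl_bipartiteMinusPath_adj.1 hij).1 with hlt | hlt
  · exact main i j hlt hij
  · rw [Sym2.eq_swap]
    exact main j i hlt hij.symm

theorem theorem4p3 :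
    -- the bounds
    (∀ (V : Type*) [Fintype V] (G : SimpleGraph V), G.Connected → Gᶜ.Connected →
      (5 ≤ Fintype.card V → md G + md Gᶜ ≤ Fintype.card V + 1) ∧
      (8 ≤ Fintype.card V → 2 ≤ md G + md Gᶜ)) ∧
    -- every tree with maximum degree `n - 2` attains the upper bound
    (∀ (V : Type*) [Fintype V] (G : SimpleGraph V) [DecidableRel G.Adj],
      5 ≤ Fintype.card V → G.IsTree → G.maxDegree + 2 = Fintype.card V →
      Gᶜ.Connected ∧ md G + md Gᶜ = Fintype.card V + 1) ∧
    -- such trees exist for all `n ≥ 5`, so the upper bound is sharp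
    (∀ n : ℕ, 5 ≤ n → ∃ (G : SimpleGraph (Fin n)) (_ : DecidableRel G.Adj),
      G.IsTree ∧ G.maxDegree + 2 = n ∧ G.Connected ∧ Gᶜ.Connected ∧ md G + md Gᶜ = n + 1) ∧
    -- the lower bound is sharp for all `n ≥ 8`, already for bipartite graphs
    (∀ n : ℕ, 8 ≤ n → ∃ G : SimpleGraph (Fin n),
      G.IsBipartite ∧ G.Connected ∧ Gᶜ.Connected ∧ md G = 1 ∧ md Gᶜ = 1) := by
  refine ⟨fun V _ G hG hGc => ⟨fun hn => ?_, fun hn => ?_⟩, fun V _ G _ => ?_, fun n hn => ?_,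
    fun n hn => ?_⟩
  · rw [← Nat.card_eq_fintype_card] at hn ⊢
    exact md_add_md_le (complementary_compl G) hG hGc hn rfl
  · have : Nontrivial V := Fintype.one_lt_card_iff_nontrivial.1 (by omega)
    exact Nat.add_le_add (one_le_md hG) (one_le_md hGc)
  · exact fun hn hG hdeg => IsTree.connected_compl_and_md_add_md hn hG hdeg
  · have htree := extendedStar_isTree hn
    classical
    have hdeg := extendedStar_maxDegree hn
    have h := IsTree.connected_compl_and_md_add_md (by rwa [Fintype.card_fin]) htree
      (by rwa [Fintype.card_fin])
    rw [Fintype.card_fin] at h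
    exact ⟨extendedStar n, inferInstance, htree, hdeg, htree.connected, h.1, h.2⟩
  · exact ⟨bipartiteMinusPath n, bipartiteMinusPath_isBipartite n,
      bipartiteMinusPath_connected hn, compl_bipartiteMinusPath_connected hn,
      md_bipartiteMinusPath hn, md_compl_bipartiteMinusPath hn⟩
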